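/- For a graph $G$, let $|C_{C_5}(G)|$ denote the number of $5$-element subsets of $V(G)$ that induce a cycle $C_5$ in $G$, and let $$\mathrm{ex}_{C_5}(n,K_3)=\max\{|C_{C_5}(G)| : G \text{ is a triangle-free graph on } n \text{ vertices}\}.$$ Then the Turán density $$\pi_{C_5}(K_3)=\lim_{n\to\infty}\frac{\mathrm{ex}_{C_5}(n,K_3)}{\binom{n}{5}}$$ exists and satisfies $$\pi_{C_5}(K_3)\le\frac{24}{625}.$$ -/

import Mathlib

namespace TuranInduced

/-- `C_A(G)`: the set of all vertex subsets `S` of `G` which induce a copy of `A` in `G`.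
Such a subset automatically has as many elements as `A` has vertices. -/
def copies {k n : ℕ} (A : SimpleGraph (Fin k)) (G : SimpleGraph (Fin n)) :
    Set (Finset (Fin n)) :=
  {S | Nonempty (A ≃g G.induce (S : Set (Fin n)))}

open Classical in
/-- `ex_A(n, B)`: the maximum of `|C_A(G)|` over all graphs `G` on `n` vertices that contain no
copy of `B` as a (not necessarily induced) subgraph. -/
noncomputable def ex {k l : ℕ} (A : SimpleGraph (Fin k)) (B : SimpleGraph (Fin l)) (n : ℕ) : ℕ :=
  (Finset.univ.filter fun G : SimpleGraph (Fin n) => B.Free G).sup fun G => (copies A G).ncard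

/-- `d` is the Turán density `π_A(B)`, the limit of `ex_A(n, B) / (n choose k)` as `n → ∞`,
where `k` is the number of vertices of `A`. -/
def IsTuranDensity {k l : ℕ} (A : SimpleGraph (Fin k)) (B : SimpleGraph (Fin l)) (d : ℝ) : Prop :=
  Filter.Tendsto (fun n : ℕ => (ex A B n : ℝ) / (n.choose k : ℝ)) Filter.atTop (nhds d)

end TuranInduced

/-!
The limit exists for every pair of graphs by averaging: a copy of `A` (on `k` vertices) in a graph
on `n + 1` vertices survives the deletion of `n + 1 - k` vertices, so `ex A B n / (n choose k)` is
antitone for `n ≥ k` (`exists_isTuranDensity`).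

The value of the bound comes from a sum-of-squares (flag algebra) certificate, used here in the
homomorphism form, where vertices may repeat; this makes it exact for every `n`: a triangle-free
graph on `n` vertices has at most `(n / 5) ^ 5` induced pentagons
(`ncard_copies_cycleGraph_five_le`). For an ordered triple `t` of root vertices inducing a given
pattern and a vector `s` indexed by the ways in which a further vertex can attach to `t`, the square
of `∑ v, s (attachment of v to t)` is nonnegative. Expanding it gives a sum over five-tuples of
vertices, so the sum over all five-tuples `x` of `patternForm`, a positive combination of nine such
products that depends only on the adjacencies inside `x`, is nonnegative (`sum_patternForm_nonneg`).
That sum does not change when the five positions are permuted. On the other hand, for each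
triangle-free graph on five labelled vertices, the sum of `patternForm` over the thirty ways to
choose roots, plus `225000` if the graph is a pentagon, is at most `8640`
(`sum_patternForm_add_isTwoRegular_le`, a finite check). Summing over all tuples, at most
`8640 / 225000 * n ^ 5 = 24 / 625 * n ^ 5` five-tuples induce a pentagon, and every pentagon
accounts for `5! = 120` of them.

The nine vectors are orthogonal to the attachment densities of all root triples in the balanced
blow-up of the pentagon, as they must be, since the bound is attained there.
-/

namespace TuranInduced

/-! ### Copies in vertex-deleted subgraphs and existence of the density -/

section Density

variable {k l : ℕ} (A : SimpleGraph (Fin k)) (B : SimpleGraph (Fin l))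

theorem ncard_copies_le_ex {n : ℕ} {G : SimpleGraph (Fin n)} (hG : B.Free G) :
    (copies A G).ncard ≤ ex A B n := by
  classical
  exact Finset.le_sup (f := fun G => (copies A G).ncard)
    (Finset.mem_filter.2 ⟨Finset.mem_univ _, hG⟩)

theorem ex_le_of_forall {n m : ℕ}
    (h : ∀ G : SimpleGraph (Fin n), B.Free G → (copies A G).ncard ≤ m) : ex A B n ≤ m := by
  classical
  exact Finset.sup_le fun G hG => h G (Finset.mem_filter.1 hG).2

variable {A}

theorem card_of_mem_copies {n : ℕ} {G : SimpleGraph (Fin n)} {S : Finset (Fin n)}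
    (hS : S ∈ copies A G) : S.card = k := by
  obtain ⟨e⟩ := hS
  simpa using (Fintype.card_congr e.toEquiv).symm

theorem mem_copies_comap {m n : ℕ} {G : SimpleGraph (Fin n)} (f : Fin m ↪ Fin n)
    {T : Finset (Fin m)} (hT : T.map f ∈ copies A G) : T ∈ copies A (G.comap f) := by
  obtain ⟨e⟩ := hT
  have hmem (t : (T : Set (Fin m))) : f t ∈ ((T.map f : Finset (Fin n)) : Set (Fin n)) := by
    simp
  have hbij : Function.Bijective fun t : (T : Set (Fin m)) =>
      (⟨f t, hmem t⟩ : ((T.map f : Finset (Fin n)) : Set (Fin n))) := by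
    constructor
    · intro s t hst
      exact Subtype.ext (f.injective (congrArg Subtype.val hst))
    · rintro ⟨y, hy⟩
      obtain ⟨t, ht, rfl⟩ := Finset.mem_map.1 (Finset.mem_coe.1 hy)
      exact ⟨⟨t, ht⟩, rfl⟩
  exact ⟨e.trans (SimpleGraph.Iso.symm ⟨Equiv.ofBijective _ hbij, Iff.rfl⟩)⟩

theorem card_copies_avoiding_le {n : ℕ} (G : SimpleGraph (Fin (n + 1))) (v : Fin (n + 1)) :
    {S ∈ copies A G | v ∉ S}.ncard ≤ (copies A (G.comap v.succAboveEmb)).ncard := by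
  have hsub : {S ∈ copies A G | v ∉ S} ⊆
      Finset.map v.succAboveEmb '' copies A (G.comap v.succAboveEmb) := by
    rintro S ⟨hS, hv⟩
    obtain ⟨T, rfl⟩ : ∃ T : Finset (Fin n), T.map v.succAboveEmb = S := by
      refine ⟨Finset.univ.filter fun i => v.succAbove i ∈ S, ?_⟩
      ext i
      simp only [Finset.mem_map, Finset.mem_filter, Finset.mem_univ, true_and,
        Fin.coe_succAboveEmb]
      constructor
      · rintro ⟨j, hj, rfl⟩
        exact hj
      · intro hi
        obtain ⟨j, rfl⟩ := Fin.exists_succAbove_eq (x := i) (y := v) (by rintro rfl; exact hv hi)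
        exact ⟨j, hi, rfl⟩
    exact ⟨T, mem_copies_comap _ hS, rfl⟩
  exact (Set.ncard_le_ncard hsub (Set.toFinite _)).trans (Set.ncard_image_le (Set.toFinite _))

variable (A)

/-- Double counting of the pairs of a copy of `A` and a vertex outside it. -/
theorem mul_ncard_copies_le {n : ℕ} {G : SimpleGraph (Fin (n + 1))} (hG : B.Free G) :
    (n + 1 - k) * (copies A G).ncard ≤ (n + 1) * ex A B n := by
  classical
  have hfin : (copies A G).Finite := Set.toFinite _
  have hdc := Finset.sum_card_bipartiteAbove_eq_sum_card_bipartiteBelow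
    (s := hfin.toFinset) (t := (Finset.univ : Finset (Fin (n + 1)))) fun S v => v ∉ S
  have hleft : ∀ S ∈ hfin.toFinset,
      (Finset.univ.bipartiteAbove (fun S (v : Fin (n + 1)) => v ∉ S) S).card = n + 1 - k := by
    intro S hS
    rw [← card_of_mem_copies (hfin.mem_toFinset.1 hS), Finset.bipartiteAbove,
      Finset.filter_not, Finset.filter_mem_eq_inter, Finset.univ_inter,
      Finset.card_univ_sdiff, Fintype.card_fin]
  have hright : ∀ v ∈ (Finset.univ : Finset (Fin (n + 1))),
      (hfin.toFinset.bipartiteBelow (fun S (v : Fin (n + 1)) => v ∉ S) v).card ≤ ex A B n := by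
    intro v _
    have hfree : B.Free (G.comap v.succAboveEmb) := fun hB =>
      hG (hB.trans ⟨(SimpleGraph.Embedding.comap v.succAboveEmb G).toCopy⟩)
    refine le_trans (le_of_eq ?_)
      ((card_copies_avoiding_le (A := A) G v).trans (ncard_copies_le_ex A B hfree))
    rw [← Set.ncard_coe_finset]
    congr 1
    ext S
    simp [Finset.bipartiteBelow]
  rw [Finset.sum_congr rfl hleft, Finset.sum_const, smul_eq_mul] at hdc
  have hsum := Finset.sum_le_card_nsmul _ _ _ hright
  rw [← hdc, Finset.card_univ, Fintype.card_fin, smul_eq_mul] at hsum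
  rwa [Set.ncard_eq_toFinset_card _ hfin, mul_comm]

theorem ex_succ_div_choose_le {n : ℕ} (hn : k ≤ n) :
    (ex A B (n + 1) : ℝ) / ((n + 1).choose k : ℝ) ≤ (ex A B n : ℝ) / (n.choose k : ℝ) := by
  have hpos : 0 < n + 1 - k := by omega
  have hle : (n + 1 - k) * ex A B (n + 1) ≤ (n + 1) * ex A B n := by
    rw [mul_comm, ← Nat.le_div_iff_mul_le hpos]
    refine ex_le_of_forall A B fun G hG => ?_
    rw [Nat.le_div_iff_mul_le hpos, mul_comm]
    exact mul_ncard_copies_le A B hG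
  have hchoose : n.choose k * (n + 1) = (n + 1).choose k * (n + 1 - k) :=
    Nat.choose_mul_succ_eq n k
  rw [div_le_div_iff₀ (by exact_mod_cast Nat.choose_pos (by omega))
    (by exact_mod_cast Nat.choose_pos hn)]
  norm_cast
  refine Nat.le_of_mul_le_mul_left ?_ hpos
  calc (n + 1 - k) * (ex A B (n + 1) * n.choose k)
      = ((n + 1 - k) * ex A B (n + 1)) * n.choose k := by ring
    _ ≤ ((n + 1) * ex A B n) * n.choose k := Nat.mul_le_mul_right _ hle
    _ = ex A B n * (n.choose k * (n + 1)) := by ring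
    _ = (n + 1 - k) * (ex A B n * (n + 1).choose k) := by rw [hchoose]; ring

theorem exists_isTuranDensity : ∃ d : ℝ, IsTuranDensity A B d := by
  have hanti : Antitone fun n : ℕ => (ex A B (n + k) : ℝ) / ((n + k).choose k : ℝ) := by
    refine antitone_nat_of_succ_le fun n => ?_
    rw [Nat.add_right_comm]
    exact ex_succ_div_choose_le A B (Nat.le_add_left k n)
  have hbdd : BddBelow
      (Set.range fun n : ℕ => (ex A B (n + k) : ℝ) / ((n + k).choose k : ℝ)) :=
    ⟨0, by rintro _ ⟨n, rfl⟩; positivity⟩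
  exact ⟨_, (Filter.tendsto_add_atTop_iff_nat
    (f := fun n : ℕ => (ex A B n : ℝ) / (n.choose k : ℝ)) k).1 (tendsto_atTop_ciInf hanti hbdd)⟩

end Density

/-! ### The sum-of-squares certificate -/

/-- An integer for each way in which a vertex can be attached to three roots: `y110`, for instance,
is the value when it is adjacent to the first two roots but not to the third. -/
def flagVector (y000 y100 y010 y110 y001 y101 y011 y111 : ℤ) : Bool → Bool → Bool → ℤ
  | false, false, false => y000
  | true, false, false => y100
  | false, true, false => y010
  | true, true, false => y110
  | false, false, true => y001
  | true, false, true => y101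
  | false, true, true => y011
  | true, true, true => y111

/-- The squares of the certificate, as pairs of a weight and a vector. The arguments are the
adjacencies `01`, `02`, `12` of the roots. Root triples with exactly one edge (two edges) are used
only when root `2` is the isolated vertex (the midpoint); the other orders of the roots are
supplied by `rootings`. Attachments that create a triangle get the value `0`. -/
def weightedFlagVectors : Bool → Bool → Bool → List (ℕ × (Bool → Bool → Bool → ℤ))
  | false, false, false => [(72, flagVector 2 (-5) (-5) 4 (-5) 4 4 (-3))]
  | true, false, false =>
    [(1701, flagVector (-2) 1 1 0 2 0 0 0),
     (27, flagVector (-2) 2 2 0 3 (-1) (-1) 0),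
     (3735, flagVector 0 1 1 0 (-1) (-1) (-1) 0),
     (297, flagVector 0 1 (-1) 0 0 (-4) 4 0),
     (2175, flagVector 0 1 (-1) 0 0 4 (-4) 0)]
  | false, true, true =>
    [(94, flagVector (-12) (-5) (-5) 2 4 0 0 0),
     (8, flagVector (-24) (-11) (-11) 2 10 0 0 0),
     (10800, flagVector 0 1 (-1) 0 0 0 0 0)]
  | _, _, _ => []

/-- The weighted sum of the products of the coordinates of two vertices `v` and `w`, whose
attachments to the roots are `v0 v1 v2` and `w0 w1 w2`. -/
def rootedForm (e01 e02 e12 v0 v1 v2 w0 w1 w2 : Bool) : ℤ :=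
  ((weightedFlagVectors e01 e02 e12).map fun s =>
    (s.1 : ℤ) * (s.2 v0 v1 v2 * s.2 w0 w1 w2)).sum

/-- `rootedForm` of a labelled graph on five vertices, given by its adjacency matrix, with roots
`0`, `1`, `2` and further vertices `3`, `4`. -/
def patternForm (M : Fin 5 → Fin 5 → Bool) : ℤ :=
  rootedForm (M 0 1) (M 0 2) (M 1 2) (M 3 0) (M 3 1) (M 3 2) (M 4 0) (M 4 1) (M 4 2)

/-- The permutations of the five positions up to those preserving `patternForm` on symmetric
matrices: exchanging the further vertices `3` and `4`, or the roots `0` and `1`. -/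
def rootings : List (Fin 5 → Fin 5) :=
  [![3, 4, 2, 0, 1], ![2, 4, 3, 0, 1], ![2, 3, 4, 0, 1], ![3, 4, 1, 0, 2], ![1, 4, 3, 0, 2],
   ![1, 3, 4, 0, 2], ![2, 4, 1, 0, 3], ![1, 4, 2, 0, 3], ![1, 2, 4, 0, 3], ![2, 3, 1, 0, 4],
   ![1, 3, 2, 0, 4], ![1, 2, 3, 0, 4], ![3, 4, 0, 1, 2], ![0, 4, 3, 1, 2], ![0, 3, 4, 1, 2],
   ![2, 4, 0, 1, 3], ![0, 4, 2, 1, 3], ![0, 2, 4, 1, 3], ![2, 3, 0, 1, 4], ![0, 3, 2, 1, 4],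
   ![0, 2, 3, 1, 4], ![1, 4, 0, 2, 3], ![0, 4, 1, 2, 3], ![0, 1, 4, 2, 3], ![1, 3, 0, 2, 4],
   ![0, 3, 1, 2, 4], ![0, 1, 3, 2, 4], ![1, 2, 0, 3, 4], ![0, 2, 1, 3, 4], ![0, 1, 2, 3, 4]]

/-- All degrees are two. A two-regular simple graph on five vertices is a pentagon; only the
converse is needed, so no isomorphism has to be found in the finite check. -/
def IsTwoRegular (M : Fin 5 → Fin 5 → Bool) : Prop :=
  ∀ i, ∑ j, (M i j).toNat = 2

instance (M : Fin 5 → Fin 5 → Bool) : Decidable (IsTwoRegular M) :=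
  inferInstanceAs (Decidable (∀ i, ∑ j, (M i j).toNat = 2))

/-- The finite check behind the bound. -/
theorem sum_patternForm_add_isTwoRegular_le {M : Fin 5 → Fin 5 → Bool}
    (hirrefl : ∀ i, M i i = false) (hsymm : ∀ i j, M i j = M j i)
    (htri : ∀ i j k, (M i j && M i k && M j k) = false) :
    (rootings.map fun r => patternForm fun i j => M (r i) (r j)).sum +
      (if IsTwoRegular M then 225000 else 0) ≤ 8640 := by
  have h012 := htri 0 1 2
  have h013 := htri 0 1 3
  have h014 := htri 0 1 4
  have h023 := htri 0 2 3
  have h024 := htri 0 2 4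
  have h034 := htri 0 3 4
  have h123 := htri 1 2 3
  have h124 := htri 1 2 4
  have h134 := htri 1 3 4
  have h234 := htri 2 3 4
  -- Both sides become functions of the ten entries above the diagonal, which are then enumerated.
  simp only [rootings, List.map_cons, List.map_nil, List.sum_cons, List.sum_nil, add_zero,
    patternForm, Matrix.cons_val, IsTwoRegular, Fin.forall_fin_succ, Fin.sum_univ_five,
    Fin.isValue, Fin.succ_zero_eq_one, Fin.succ_one_eq_two, Fin.reduceSucc, hirrefl,
    hsymm 1 0, hsymm 2 0, hsymm 2 1, hsymm 3 0, hsymm 3 1, hsymm 3 2, hsymm 4 0, hsymm 4 1,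
    hsymm 4 2, hsymm 4 3, IsEmpty.forall_iff, and_true, Bool.toNat_false, zero_add]
  clear htri hsymm hirrefl
  generalize M 0 1 = e01, M 0 2 = e02, M 0 3 = e03, M 0 4 = e04, M 1 2 = e12, M 1 3 = e13,
    M 1 4 = e14, M 2 3 = e23, M 2 4 = e24, M 3 4 = e34 at *
  clear M
  revert h234 h134 h124 h034 h024 h014 e34 e24 e14 e04 h123 h023 h013 e23 e13 e03 h012 e12 e02 e01
  decide +kernel

/-! ### Averaging over five-tuples of vertices -/

section Averaging

variable {V : Type*} [Fintype V]

/-- For every entry of the list, the double sum is a weighted square `(∑ v, f s.2 v) ^ 2`. -/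
theorem sum_sum_list_mul_nonneg {α : Type*} (L : List (ℕ × α)) (f : α → V → ℤ) :
    0 ≤ ∑ v, ∑ w, (L.map fun s => (s.1 : ℤ) * (f s.2 v * f s.2 w)).sum := by
  induction L with
  | nil => simp
  | cons s L ih =>
    simp only [List.map_cons, List.sum_cons, Finset.sum_add_distrib]
    refine add_nonneg ?_ ih
    simp only [← Finset.mul_sum, ← Finset.sum_mul]
    exact mul_nonneg (Int.natCast_nonneg _) (mul_self_nonneg _)

/-- A five-tuple consists of three roots and two further vertices. -/
def fiveTupleEquiv (V : Type*) : (V × V × V) × V × V ≃ (Fin 5 → V) where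
  toFun p := ![p.1.1, p.1.2.1, p.1.2.2, p.2.1, p.2.2]
  invFun x := ((x 0, x 1, x 2), x 3, x 4)
  left_inv _ := rfl
  right_inv x := by
    ext i
    fin_cases i <;> rfl

theorem sum_patternForm_nonneg (R : V → V → Bool) :
    0 ≤ ∑ x : Fin 5 → V, patternForm fun i j => R (x i) (x j) := by
  rw [← (fiveTupleEquiv V).sum_comp, Fintype.sum_prod_type]
  refine Finset.sum_nonneg fun t _ => ?_
  rw [Fintype.sum_prod_type]
  exact sum_sum_list_mul_nonneg (weightedFlagVectors (R t.1 t.2.1) (R t.1 t.2.2) (R t.2.1 t.2.2))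
    fun s v => s (R v t.1) (R v t.2.1) (R v t.2.2)

theorem sum_comp_eq_of_bijective {ι : Type*} [Fintype ι] [DecidableEq ι] {r : ι → ι}
    (hr : Function.Bijective r) (g : (ι → V) → ℤ) : ∑ x : ι → V, g (x ∘ r) = ∑ x, g x :=
  ((Equiv.ofBijective r hr).symm.arrowCongr (Equiv.refl V)).sum_comp g

theorem injective_of_mem_rootings : ∀ r ∈ rootings, Function.Injective r := by
  simp only [rootings, List.forall_mem_cons, List.not_mem_nil, IsEmpty.forall_iff, implies_true,
    and_true]
  repeat' apply And.intro
  all_goals decide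

/-- A triangle-free graph, given by its adjacency function, has at most `24 / 625 * |V| ^ 5` ordered
five-tuples that induce a two-regular graph. -/
theorem card_isTwoRegular_le {R : V → V → Bool} (hirrefl : ∀ v, R v v = false)
    (hsymm : ∀ v w, R v w = R w v) (htri : ∀ u v w, (R u v && R u w && R v w) = false) :
    225000 * (Finset.univ.filter fun x : Fin 5 → V => IsTwoRegular fun i j => R (x i) (x j)).card ≤
      8640 * Fintype.card V ^ 5 := by
  classical
  have hnonneg : ∀ L : List (Fin 5 → Fin 5), (∀ r ∈ L, Function.Injective r) →
      0 ≤ ∑ x : Fin 5 → V,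
        (L.map fun r => patternForm fun i j => R (x (r i)) (x (r j))).sum := by
    intro L
    induction L with
    | nil => simp
    | cons r L ih =>
      intro hL
      simp only [List.map_cons, List.sum_cons, Finset.sum_add_distrib]
      refine add_nonneg ?_ (ih fun s hs => hL s (List.mem_cons_of_mem _ hs))
      have hr := Finite.injective_iff_bijective.1 (hL r List.mem_cons_self)
      exact (sum_patternForm_nonneg R).trans_eq
        (sum_comp_eq_of_bijective hr fun x => patternForm fun i j => R (x i) (x j)).symm
  have hsum := Finset.sum_le_sum fun (x : Fin 5 → V) (_ : x ∈ Finset.univ) =>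
    sum_patternForm_add_isTwoRegular_le (M := fun i j => R (x i) (x j))
      (fun i => hirrefl _) (fun i j => hsymm _ _) (fun i j k => htri _ _ _)
  rw [Finset.sum_add_distrib, ← Finset.sum_filter, Finset.sum_const, Finset.sum_const,
    Finset.card_univ, Fintype.card_fun, Fintype.card_fin] at hsum
  have := hnonneg rootings injective_of_mem_rootings
  simp only [nsmul_eq_mul] at hsum
  zify
  push_cast at hsum
  linarith

end Averaging

/-! ### Counting pentagons -/

/-- A pentagon in `G` comes with `5!` enumerations of its vertices, each a two-regular five-tuple. -/
theorem factorial_five_mul_ncard_copies_le {n : ℕ} (G : SimpleGraph (Fin n)) [DecidableRel G.Adj] :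
    120 * (copies (SimpleGraph.cycleGraph 5) G).ncard ≤
      (Finset.univ.filter fun x : Fin 5 → Fin n =>
        IsTwoRegular fun i j => decide (G.Adj (x i) (x j))).card := by
  classical
  have hfin : (copies (SimpleGraph.cycleGraph 5) G).Finite := Set.toFinite _
  have hex : ∀ S ∈ copies (SimpleGraph.cycleGraph 5) G, ∃ φ : Fin 5 → Fin n,
      Function.Injective φ ∧ Finset.univ.image φ = S ∧
        ∀ i j, G.Adj (φ i) (φ j) ↔ (SimpleGraph.cycleGraph 5).Adj i j := by
    rintro S ⟨e⟩
    refine ⟨fun i => (e i).1, fun i j hij => e.injective (Subtype.ext hij), ?_,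
      fun i j => e.map_adj_iff⟩
    ext v
    simp only [Finset.mem_image, Finset.mem_univ, true_and]
    constructor
    · rintro ⟨i, rfl⟩
      exact (e i).2
    · intro hv
      exact ⟨e.symm ⟨v, hv⟩, by simp⟩
  obtain hempty | ⟨S₀, hS₀⟩ := (copies (SimpleGraph.cycleGraph 5) G).eq_empty_or_nonempty
  · simp [hempty]
  -- `choose!` below needs a default five-tuple, which does not exist for `n = 0`.
  have : Nonempty (Fin n) := ⟨(hex S₀ hS₀).choose 0⟩
  choose! φ hinj himage hadj using hex
  have hcard : (hfin.toFinset ×ˢ (Finset.univ : Finset (Equiv.Perm (Fin 5)))).card =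
      120 * (copies (SimpleGraph.cycleGraph 5) G).ncard := by
    rw [Finset.card_product, Finset.card_univ, Fintype.card_perm, Fintype.card_fin,
      Set.ncard_eq_toFinset_card _ hfin, mul_comm]
    rfl
  rw [← hcard]
  refine Finset.card_le_card_of_injOn (fun p => φ p.1 ∘ p.2) ?_ ?_
  · rintro ⟨S, σ⟩ hp
    have hS : S ∈ copies (SimpleGraph.cycleGraph 5) G := by simpa using hp
    have hreg : ∀ i, ∑ j, (decide ((SimpleGraph.cycleGraph 5).Adj i j)).toNat = 2 := by decide
    simp only [Finset.coe_filter, Finset.mem_univ, true_and, Set.mem_ofPred_eq]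
    intro i
    simp only [Function.comp_apply, hadj S hS]
    rw [← hreg (σ i)]
    exact Equiv.sum_comp σ fun j => (decide ((SimpleGraph.cycleGraph 5).Adj (σ i) j)).toNat
  · rintro ⟨S, σ⟩ hp ⟨T, τ⟩ hq hpq
    have hS : S ∈ copies (SimpleGraph.cycleGraph 5) G := by simpa using hp
    have hT : T ∈ copies (SimpleGraph.cycleGraph 5) G := by simpa using hq
    have hrange : ∀ (U : Finset (Fin n)) (ρ : Equiv.Perm (Fin 5)),
        Set.range (φ U ∘ ρ) = Set.range (φ U) := fun U ρ => ρ.surjective.range_comp _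
    have hST : S = T := by
      rw [← himage S hS, ← himage T hT, ← Finset.coe_inj]
      simp only [Finset.coe_image, Finset.coe_univ, Set.image_univ]
      rw [← hrange S σ, ← hrange T τ]
      exact congrArg Set.range hpq
    subst hST
    congr 1
    exact Equiv.ext fun i => hinj S hS (congrFun hpq i)

/-- A triangle-free graph on `n` vertices has at most `(n / 5) ^ 5` induced pentagons. -/
theorem ncard_copies_cycleGraph_five_le {n : ℕ} {G : SimpleGraph (Fin n)}
    (hG : (⊤ : SimpleGraph (Fin 3)).Free G) :
    3125 * (copies (SimpleGraph.cycleGraph 5) G).ncard ≤ n ^ 5 := by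
  classical
  have hfree : G.CliqueFree 3 := by
    simpa using SimpleGraph.cliqueFree_iff_top_free.2 hG
  have hcount := factorial_five_mul_ncard_copies_le G
  have hbound := card_isTwoRegular_le (R := fun v w => decide (G.Adj v w))
    (fun v => by simp) (fun v w => by simp [G.adj_comm]) (fun u v w => by
      by_contra h
      simp only [Bool.not_eq_false, Bool.and_eq_true, decide_eq_true_eq] at h
      exact hfree {u, v, w} (SimpleGraph.is3Clique_triple_iff.2 ⟨h.1.1, h.1.2, h.2⟩))
  rw [Fintype.card_fin] at hbound
  omega

/-- With `n = m + 5`, the estimate `(n - 4) ^ 5 ≤ 5! * (n choose 5)` turns the bound `(n / 5) ^ 5` into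
one that visibly tends to `24 / 625`. -/
theorem ex_cycleGraph_five_div_choose_le (m : ℕ) :
    (ex (SimpleGraph.cycleGraph 5) (⊤ : SimpleGraph (Fin 3)) (m + 1 + 4) : ℝ) /
      ((m + 1 + 4).choose 5 : ℝ) ≤ 24 / 625 * (1 + 4 / ((m : ℝ) + 1)) ^ 5 := by
  have hex : 3125 * ex (SimpleGraph.cycleGraph 5) (⊤ : SimpleGraph (Fin 3)) (m + 1 + 4) ≤
      (m + 1 + 4) ^ 5 := by
    have := ex_le_of_forall (SimpleGraph.cycleGraph 5) (⊤ : SimpleGraph (Fin 3))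
      (n := m + 1 + 4) (m := (m + 1 + 4) ^ 5 / 3125) fun G hG => by
        rw [Nat.le_div_iff_mul_le (by norm_num), mul_comm]
        exact ncard_copies_cycleGraph_five_le hG
    omega
  have hchoose : (m + 1) ^ 5 ≤ 120 * (m + 1 + 4).choose 5 := by
    have h := Nat.pow_sub_le_descFactorial (m + 1 + 4) 5
    rw [Nat.descFactorial_eq_factorial_mul_choose] at h
    simpa [Nat.factorial] using h
  have hpos : (0 : ℝ) < (m : ℝ) + 1 := by positivity
  have hexR : (3125 : ℝ) * ex (SimpleGraph.cycleGraph 5) (⊤ : SimpleGraph (Fin 3)) (m + 1 + 4) ≤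
      ((m : ℝ) + 1 + 4) ^ 5 := by exact_mod_cast hex
  have hchooseR : ((m : ℝ) + 1) ^ 5 ≤ 120 * ((m + 1 + 4).choose 5 : ℝ) := by
    exact_mod_cast hchoose
  rw [div_le_iff₀ (by exact_mod_cast Nat.choose_pos (by omega)),
    show 1 + 4 / ((m : ℝ) + 1) = ((m : ℝ) + 1 + 4) / ((m : ℝ) + 1) by field_simp, div_pow]
  have hone : 1 ≤ 120 * ((m + 1 + 4).choose 5 : ℝ) / ((m : ℝ) + 1) ^ 5 :=
    (one_le_div (pow_pos hpos 5)).2 hchooseR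
  calc (ex (SimpleGraph.cycleGraph 5) (⊤ : SimpleGraph (Fin 3)) (m + 1 + 4) : ℝ)
      ≤ ((m : ℝ) + 1 + 4) ^ 5 / 3125 := by linarith
    _ ≤ ((m : ℝ) + 1 + 4) ^ 5 / 3125 *
          (120 * ((m + 1 + 4).choose 5 : ℝ) / ((m : ℝ) + 1) ^ 5) :=
        le_mul_of_one_le_right (by positivity) hone
    _ = 24 / 625 * (((m : ℝ) + 1 + 4) ^ 5 / ((m : ℝ) + 1) ^ 5) *
          ((m + 1 + 4).choose 5 : ℝ) := by ring

end TuranInduced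

theorem theorem1 :
    ∃ d : ℝ, TuranInduced.IsTuranDensity (SimpleGraph.cycleGraph 5) (⊤ : SimpleGraph (Fin 3)) d ∧
      d ≤ 24 / 625 := by
  obtain ⟨d, hd⟩ := TuranInduced.exists_isTuranDensity (SimpleGraph.cycleGraph 5)
    (⊤ : SimpleGraph (Fin 3))
  refine ⟨d, hd, ?_⟩
  have hbound : Filter.Tendsto (fun m : ℕ => (24 / 625 : ℝ) * (1 + 4 / ((m : ℝ) + 1)) ^ 5)
      Filter.atTop (nhds (24 / 625)) := by
    have h : Filter.Tendsto (fun m : ℕ => (4 : ℝ) / ((m : ℝ) + 1)) Filter.atTop (nhds 0) := by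
      simpa [div_eq_mul_inv] using tendsto_one_div_add_atTop_nhds_zero_nat.const_mul (4 : ℝ)
    simpa using ((h.const_add 1).pow 5).const_mul (24 / 625 : ℝ)
  exact le_of_tendsto_of_tendsto' ((Filter.tendsto_add_atTop_iff_nat 5).2 hd) hbound
    TuranInduced.ex_cycleGraph_five_div_choose_le
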